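/- Throughout, $\mathbb{Q}$ denotes the real quaternions, and $\mathbb{C}=\mathbb{R}+\mathbb{R}\mathbf{i}\subset\mathbb{Q}$. Let $n_3\ge 1$. A tensor $\mathcal{A}\in\mathbb{Q}^{n_1\times n_2\times n_3}$ has frontal slices $\mathcal{A}^{(1)},\dots,\mathcal{A}^{(n_3)}\in\mathbb{Q}^{n_1\times n_2}$ and is written uniquely as $\mathcal{A}=\mathcal{A}_{\mathbf d}+\mathbf{j}\mathcal{A}_{\mathbf c}$ with complex tensors $\mathcal{A}_{\mathbf d},\mathcal{A}_{\mathbf c}$. Let $\mathtt{bcirc}(\mathcal{B})$ be the block circulant matrix whose block $(s,t)$ is $\mathcal{B}^{(r)}$ with $r\equiv s-t+1 \pmod{n_3}$, let $P_{n_3}$ be the $n_3\times n_3$ permutation matrix with entry $1$ at $(s,t)$ exactly when $s+t\equiv 2\pmod{n_3}$, and put $$\mathtt{bcirc_z}(\mathcal{A})=\mathtt{bcirc}(\mathcal{A}_{\mathbf d})+\mathbf{j}\,\mathtt{bcirc}(\mathcal{A}_{\mathbf c})(P_{n_3}\otimes I_{n_2}).$$ The QT-product $\mathcal{A}*_Q\mathcal{B}$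 is the tensor whose frontal slices, stacked in a block column, form the product of $\mathtt{bcirc_z}(\mathcal{A})$ with the block column of the frontal slices of $\mathcal{B}$. Its identity $\mathcal{I}$ has first frontal slice $I_n$ and all others zero, and $\mathcal{P}$ is invertible if $\mathcal{P}*_Q\mathcal{P}^{-1}=\mathcal{P}^{-1}*_Q\mathcal{P}=\mathcal{I}$ for some tensor $\mathcal{P}^{-1}$. Let $F_{n_3}=\big(n_3^{-1/2}\omega^{(s-1)(t-1)}\big)_{s,t}$ with $\omega=e^{-2\pi\mathbf{i}/n_3}$. A Jordan canonical form of $A\in\mathbb{Q}^{n\times n}$ is a direct sum $J$ of complex Jordan blocks, with $A=PJP^{-1}$ for an invertible $P\in\mathbb{Q}^{n\times n}$, such that the diagonal entries of $J$ are exactly the complex right eigenvalues of $A$ with nonnegative imaginary part ($\mu$ is a right eigenvalue if $Ax=x\mu$ for some $x\neq0$). A tensor $\mathcal{J}\in\mathbb{Q}^{n\times n\times n_3}$ is a QT-Jordan canonical form of $\mathcal{A}\in\mathbb{Q}^{n\times n\times n_3}$ if $$(F_{n_3}\otimes I_n)\,\mathtt{bcirc_z}(\mathcal{A})\,(F_{n_3}^*\otimes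 I_n)=\mathrm{diag}(\hat A_{(1)},\dots,\hat A_{(n_3)}),\qquad (F_{n_3}\otimes I_n)\,\mathtt{bcirc_z}(\mathcal{J})\,(F_{n_3}^*\otimes I_n)=\mathrm{diag}(\hat J_{(1)},\dots,\hat J_{(n_3)})$$ are block diagonal with blocks of size $n\times n$, and each $\hat J_{(s)}$ is a Jordan canonical form of $\hat A_{(s)}$. **Lemma (QT-Jordan decomposition).** For every $\mathcal{A}\in\mathbb{Q}^{n\times n\times n_3}$ there are an invertible tensor $\mathcal{P}\in\mathbb{Q}^{n\times n\times n_3}$ and a QT-Jordan canonical form $\mathcal{J}\in\mathbb{Q}^{n\times n\times n_3}$ of $\mathcal{A}$, all of whose frontal slices are upper triangular, such that $$\mathcal{A}=\mathcal{P}*_Q\mathcal{J}*_Q\mathcal{P}^{-1}.$$ -/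

import Mathlib

open scoped Quaternion Kronecker Matrix

noncomputable section

/-- Third-order tensors of size `n₁ × n₂ × n₃` over `R`, given by their `n₃` frontal slices
(numbered from `0`, so that `A s` is the slice usually written `A^(s+1)`). -/
abbrev Tensor3 (R : Type) (n₁ n₂ n₃ : ℕ) : Type := Fin n₃ → Matrix (Fin n₁) (Fin n₂) R

/-- The quaternion unit `𝐣`. -/
def quatJ : ℍ[ℝ] := ⟨0, 0, 1, 0⟩

/-- Entrywise inclusion of complex matrices into quaternion matrices (`ℂ = ℝ + ℝ𝐢`). -/
def toQuat {m n : Type} (M : Matrix m n ℂ) : Matrix m n ℍ[ℝ] :=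
  M.map fun z : ℂ => (z : ℍ[ℝ])

/-- The complex tensor `A_d` in `A = A_d + 𝐣 A_c`. -/
def partD {n₁ n₂ n₃ : ℕ} (A : Tensor3 ℍ[ℝ] n₁ n₂ n₃) : Tensor3 ℂ n₁ n₂ n₃ :=
  fun s => (A s).map fun a => (⟨a.re, a.imI⟩ : ℂ)

/-- The complex tensor `A_c` in `A = A_d + 𝐣 A_c`. -/
def partC {n₁ n₂ n₃ : ℕ} (A : Tensor3 ℍ[ℝ] n₁ n₂ n₃) : Tensor3 ℂ n₁ n₂ n₃ :=
  fun s => (A s).map fun a => (⟨a.imJ, -a.imK⟩ : ℂ)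

/-- Each frontal slice satisfies `A = A_d + 𝐣 A_c`. -/
theorem slice_eq_partD_add_partC {n₁ n₂ n₃ : ℕ} (A : Tensor3 ℍ[ℝ] n₁ n₂ n₃) (s : Fin n₃) :
    A s = toQuat (partD A s) + quatJ • toQuat (partC A s) := by
  funext i k
  change A s i k = (((⟨(A s i k).re, (A s i k).imI⟩ : ℂ) : ℍ[ℝ])) +
    quatJ * (((⟨(A s i k).imJ, -(A s i k).imK⟩ : ℂ) : ℍ[ℝ]))
  have h0 : quatJ.re = 0 := rfl
  have h1 : quatJ.imI = 0 := rfl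
  have h2 : quatJ.imJ = 1 := rfl
  have h3 : quatJ.imK = 0 := rfl
  ext <;> simp [h0, h1, h2, h3]

/-- The block circulant matrix: block `(s, t)` is the slice with number `s - t` modulo `n₃`. -/
def bcirc {R : Type} {n₁ n₂ n₃ : ℕ} (A : Tensor3 R n₁ n₂ n₃) :
    Matrix (Fin n₃ × Fin n₁) (Fin n₃ × Fin n₂) R :=
  fun p q => A (p.1 - q.1) p.2 q.2

/-- The permutation matrix `P_{n₃}`: the entry `(s, t)` is `1` if `s + t ≡ 0` modulo `n₃`. -/
def flipPerm (n₃ : ℕ) [NeZero n₃] : Matrix (Fin n₃) (Fin n₃) ℂ :=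
  fun s t => if s + t = 0 then 1 else 0

/-- The `z`-block circulant matrix `bcirc(A_d) + 𝐣 bcirc(A_c) (P_{n₃} ⊗ I)`. -/
def bcircZ {n₁ n₂ n₃ : ℕ} [NeZero n₃] (A : Tensor3 ℍ[ℝ] n₁ n₂ n₃) :
    Matrix (Fin n₃ × Fin n₁) (Fin n₃ × Fin n₂) ℍ[ℝ] :=
  toQuat (bcirc (partD A)) +
    quatJ • toQuat (bcirc (partC A) * (flipPerm n₃ ⊗ₖ (1 : Matrix (Fin n₂) (Fin n₂) ℂ)))

/-- The block column of the frontal slices. -/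
def unfoldT {n₁ n₂ n₃ : ℕ} (A : Tensor3 ℍ[ℝ] n₁ n₂ n₃) :
    Matrix (Fin n₃ × Fin n₁) (Fin n₂) ℍ[ℝ] :=
  fun p k => A p.1 p.2 k

/-- The inverse of `unfoldT`. -/
def foldT {n₁ n₂ n₃ : ℕ} (M : Matrix (Fin n₃ × Fin n₁) (Fin n₂) ℍ[ℝ]) :
    Tensor3 ℍ[ℝ] n₁ n₂ n₃ :=
  fun s i k => M (s, i) k

/-- The QT-product `A *_Q B`. -/
def qtMul {n₁ r n₂ n₃ : ℕ} [NeZero n₃] (A : Tensor3 ℍ[ℝ] n₁ r n₃) (B : Tensor3 ℍ[ℝ] r n₂ n₃) :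
    Tensor3 ℍ[ℝ] n₁ n₂ n₃ :=
  foldT (bcircZ A * unfoldT B)

/-- The identity tensor: the first frontal slice is the identity, the others vanish. -/
def qtOne (n n₃ : ℕ) [NeZero n₃] : Tensor3 ℍ[ℝ] n n n₃ :=
  fun s => if s = 0 then 1 else 0

/-- `Q` is the two-sided inverse `P⁻¹` of `P` for the QT-product. -/
def IsQTInverse {n n₃ : ℕ} [NeZero n₃] (P Q : Tensor3 ℍ[ℝ] n n n₃) : Prop :=
  qtMul P Q = qtOne n n₃ ∧ qtMul Q P = qtOne n n₃

/-- Every frontal slice is upper triangular. -/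
def IsFUpperTriangular {n n₃ : ℕ} (A : Tensor3 ℍ[ℝ] n n n₃) : Prop :=
  ∀ s, ∀ i k : Fin n, k < i → A s i k = 0

/-- The normalized discrete Fourier matrix, with `ω = exp(-2π𝐢/n₃)`. -/
def dftMatrix (n₃ : ℕ) : Matrix (Fin n₃) (Fin n₃) ℂ :=
  fun s t => ((Real.sqrt n₃ : ℝ) : ℂ)⁻¹ *
    Complex.exp (-(2 * Real.pi * Complex.I) / n₃) ^ ((s : ℕ) * (t : ℕ))

/-- The matrix `(F_{n₃} ⊗ I) bcirc_z(A) (F_{n₃}^* ⊗ I)`. -/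
def dftConj {n n₃ : ℕ} [NeZero n₃] (A : Tensor3 ℍ[ℝ] n n n₃) :
    Matrix (Fin n₃ × Fin n) (Fin n₃ × Fin n) ℍ[ℝ] :=
  toQuat (dftMatrix n₃ ⊗ₖ (1 : Matrix (Fin n) (Fin n) ℂ)) * bcircZ A *
    toQuat ((dftMatrix n₃)ᴴ ⊗ₖ (1 : Matrix (Fin n) (Fin n) ℂ))

/-- The block diagonal matrix whose diagonal blocks are the frontal slices of `B`. -/
def blockDiag3 {n n₃ : ℕ} (B : Tensor3 ℍ[ℝ] n n n₃) :
    Matrix (Fin n₃ × Fin n) (Fin n₃ × Fin n) ℍ[ℝ] :=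
  fun p q => if p.1 = q.1 then B p.1 p.2 q.2 else 0

/-- `μ` is a right eigenvalue of the quaternion matrix `A`: `A x = x μ` for some `x ≠ 0`. -/
def IsRightEigenvalue {n : ℕ} (A : Matrix (Fin n) (Fin n) ℍ[ℝ]) (μ : ℍ[ℝ]) : Prop :=
  ∃ x : Fin n → ℍ[ℝ], x ≠ 0 ∧ A *ᵥ x = fun i => x i * μ

/-- `K` is a direct sum of Jordan blocks: all entries off the diagonal and the superdiagonal
vanish, every superdiagonal entry is `0` or `1`, and where it is `1` the two adjacent diagonal
entries agree (the blocks end at the zeros of the superdiagonal). -/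
def IsJordanMatrix {n : ℕ} (K : Matrix (Fin n) (Fin n) ℂ) : Prop :=
  (∀ i k : Fin n, k ≠ i → (k : ℕ) ≠ (i : ℕ) + 1 → K i k = 0) ∧
    ∀ i k : Fin n, (k : ℕ) = (i : ℕ) + 1 → K i k = 0 ∨ (K i k = 1 ∧ K i i = K k k)

/-- `J` is a Jordan canonical form of the quaternion matrix `A`: it is a complex Jordan matrix,
its diagonal entries are exactly the complex right eigenvalues of `A` with nonnegative imaginary
part, and `A = P J P⁻¹` for some invertible quaternion matrix `P`. -/
def IsQuatJordanForm {n : ℕ} (A J : Matrix (Fin n) (Fin n) ℍ[ℝ]) : Prop :=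
  (∃ K : Matrix (Fin n) (Fin n) ℂ, IsJordanMatrix K ∧ J = toQuat K ∧
      ∀ μ : ℂ, (∃ i, K i i = μ) ↔ (0 ≤ μ.im ∧ IsRightEigenvalue A (μ : ℍ[ℝ]))) ∧
    ∃ P Q : Matrix (Fin n) (Fin n) ℍ[ℝ], P * Q = 1 ∧ Q * P = 1 ∧ A = P * J * Q

/-- `J` is a QT-Jordan canonical form of `A`: the Fourier matrix block diagonalizes both
`bcirc_z(A)` and `bcirc_z(J)`, and each diagonal block of the latter is a Jordan canonical form of
the corresponding diagonal block of the former. -/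
def IsQTJordanForm {n n₃ : ℕ} [NeZero n₃] (A J : Tensor3 ℍ[ℝ] n n n₃) : Prop :=
  ∃ Ahat Jhat : Tensor3 ℍ[ℝ] n n n₃,
    dftConj A = blockDiag3 Ahat ∧ dftConj J = blockDiag3 Jhat ∧
      ∀ s, IsQuatJordanForm (Ahat s) (Jhat s)

end

/-! The Fourier transform along the third mode turns the QT-product into slicewise multiplication of
quaternion matrices. The entry of `bcircZ A` at block `(s, t)` is `A_d (s - t) + 𝐣 A_c (s + t)`.
Moving a Fourier coefficient past `𝐣` conjugates it, which reverses the sign of the shift; the flip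
in the second summand compensates exactly for this. Hence `F ⊗ I` block diagonalizes `bcircZ A`,
with the transformed slices `dftSlices A` as blocks (`dftMatrix_mul_bcircZ`), and `dftSlices` is
bijective and multiplicative. It remains to put each block into Jordan form and to transform back.

The Jordan form of a quaternion matrix comes from a Jordan basis of an `ℍ`-linear map `f`
(`hasJordanBasis_quaternion`). A complex eigenvalue `μ` of `f` gives the real polynomial with roots
`μ` and its conjugate; its coefficients are central, so its value at `f` is `ℍ`-linear. Fitting's
decomposition splits off the kernel of a power of it. On this kernel, if `μ` is real, `f - μ` is
nilpotent. Otherwise the kernel is `E ⊕ 𝐣E` with `E` a complex generalized eigenspace, and a complex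
Jordan basis of `E` is a quaternion Jordan basis of the kernel. -/

/-- `f` has a Jordan basis with eigenvalues in `S`: each basis vector `b i` is mapped to
`c i • b i`, or to `c i • b i + b (i + 1)` with `c (i + 1) = c i`, where `c i ∈ S`. -/
def HasJordanBasis {D V : Type*} [DivisionRing D] [AddCommGroup V] [Module D V]
    (S : Set D) (f : V →ₗ[D] V) : Prop :=
  ∃ (k : ℕ) (b : Module.Basis (Fin k) D V) (c : Fin k → D), (∀ i, c i ∈ S) ∧
    ∀ i, f (b i) = c i • b i ∨
      ∃ j : Fin k, (j : ℕ) = i + 1 ∧ c j = c i ∧ f (b i) = c i • b i + b j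

/-! ### Nilpotent endomorphisms over a division ring. -/

section DivisionRing

variable {D V : Type*} [DivisionRing D] [AddCommGroup V] [Module D V]

theorem HasJordanBasis.of_subsingleton [Subsingleton V] (S : Set D) (f : V →ₗ[D] V) :
    HasJordanBasis S f :=
  ⟨0, Module.Basis.empty V, fun i => i.elim0, fun i => i.elim0, fun i => i.elim0⟩

theorem HasJordanBasis.of_isCompl {S : Set D} {f : V →ₗ[D] V} {U W : Submodule D V}
    (h : IsCompl U W) (hU : ∀ u ∈ U, f u ∈ U) (hW : ∀ u ∈ W, f u ∈ W)
    (hJU : HasJordanBasis S (f.restrict hU)) (hJW : HasJordanBasis S (f.restrict hW)) :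
    HasJordanBasis S f := by
  obtain ⟨k, b, c, hc, hb⟩ := hJU
  obtain ⟨l, b', c', hc', hb'⟩ := hJW
  let B := ((b.prod b').map (Submodule.prodEquivOfIsCompl U W h)).reindex finSumFinEquiv
  have hBl (i : Fin k) : B (Fin.castAdd l i) = b i := by simp [B]
  have hBr (i : Fin l) : B (Fin.natAdd k i) = b' i := by simp [B]
  refine ⟨k + l, B, Fin.addCases c c', fun i => ?_, fun i => ?_⟩
  · refine Fin.addCases (fun i => ?_) (fun i => ?_) i
    · simpa using hc i
    · simpa using hc' i
  · refine Fin.addCases (fun i => ?_) (fun i => ?_) i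
    · rw [hBl]
      refine (hb i).imp (fun h => ?_) ?_
      · simpa using congrArg Subtype.val h
      · rintro ⟨j, hj, hcj, h⟩
        exact ⟨Fin.castAdd l j, by simpa using hj, by simpa using hcj,
          by simpa [hBl] using congrArg Subtype.val h⟩
    · rw [hBr]
      refine (hb' i).imp (fun h => ?_) ?_
      · simpa using congrArg Subtype.val h
      · rintro ⟨j, hj, hcj, h⟩
        exact ⟨Fin.natAdd k j, by simp [hj, add_assoc], by simpa using hcj,
          by simpa [hBr] using congrArg Subtype.val h⟩

/-- The span of a cyclic chain of maximal length of a nilpotent endomorphism has an invariant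
complement. -/
theorem exists_cyclic_isCompl [FiniteDimensional D V] (g : V →ₗ[D] V) (k : ℕ)
    (hk : g ^ (k + 1) = 0) (v : V) (hv : (g ^ k) v ≠ 0) :
    ∃ (U W : Submodule D V) (b : Module.Basis (Fin (k + 1)) D U), IsCompl U W ∧
      (∀ w ∈ W, g w ∈ W) ∧ ∀ i : Fin (k + 1), (b i : V) = (g ^ (i : ℕ)) v := by
  have hz (m : ℕ) (hm : k < m) (w : V) : (g ^ m) w = 0 := by
    rw [pow_eq_zero_of_le hm hk, LinearMap.zero_apply]
  have hinj : LinearMap.ker (LinearMap.toSpanSingleton D V ((g ^ k) v)) = ⊥ := by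
    rw [LinearMap.ker_eq_bot']
    intro a ha
    simpa [hv] using ha
  -- The functional `φ` takes the value `1` at the end of the chain. The complement is the common
  -- kernel of the maps `φ ∘ g ^ l`.
  obtain ⟨φ, hφ⟩ := LinearMap.exists_leftInverse_of_injective _ hinj
  have hφv : φ ((g ^ k) v) = 1 := by simpa using LinearMap.congr_fun hφ 1
  let Φ : V →ₗ[D] (Fin (k + 1) → D) := LinearMap.pi fun i => φ ∘ₗ (g ^ (i : ℕ))
  let C : (Fin (k + 1) → D) →ₗ[D] V :=
    (Fintype.linearCombination D fun i : Fin (k + 1) => (g ^ (i : ℕ)) v)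
  have hΦC (a : Fin (k + 1) → D) (l : Fin (k + 1)) :
      Φ (C a) l = ∑ i, a i * φ ((g ^ ((l : ℕ) + i)) v) := by
    simp [Φ, C, Fintype.linearCombination_apply, pow_add]
  have hbij : Function.Injective (Φ ∘ₗ C) := by
    rw [← LinearMap.ker_eq_bot, LinearMap.ker_eq_bot']
    intro a ha
    by_contra hne
    have hex : ∃ m, ∃ h : m < k + 1, a ⟨m, h⟩ ≠ 0 := by
      obtain ⟨i, hi⟩ := Function.ne_iff.mp hne
      exact ⟨i, i.2, hi⟩
    classical
    obtain ⟨hm, hma⟩ := Nat.find_spec hex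
    have hmin (i : ℕ) (hi : i < Nat.find hex) : ¬ ∃ h : i < k + 1, a ⟨i, h⟩ ≠ 0 :=
      Nat.find_min hex hi
    generalize Nat.find hex = m at hm hma hmin
    -- `Φ ∘ C` is anti-triangular: `φ (g ^ (l + i) v)` is `1` for `l + i = k` and `0` for `l + i >
    -- k`. If `m` is the least index with `a m ≠ 0`, coordinate `k - m` sees only `a m`.
    have h1 := congrFun ha ⟨k - m, by omega⟩
    rw [LinearMap.comp_apply, hΦC, Finset.sum_eq_single ⟨m, hm⟩] at h1
    · apply hma
      have : k - m + m = k := by omega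
      simpa [this, hφv] using h1
    · intro i _ hi
      rcases lt_or_ge (i : ℕ) m with h | h
      · have := hmin i h
        push Not at this
        rw [this i.2, zero_mul]
      · have : (i : ℕ) ≠ m := fun h => hi (Fin.ext h)
        rw [hz _ (by simp only; omega), map_zero, mul_zero]
    · simp
  have hsurj : Function.Surjective (Φ ∘ₗ C) := LinearMap.surjective_of_injective hbij
  have hC : Function.Injective C := Function.Injective.of_comp (f := Φ) hbij
  refine ⟨LinearMap.range C, LinearMap.ker Φ,
    (Pi.basisFun D (Fin (k + 1))).map (LinearEquiv.ofInjective C hC), ⟨?_, ?_⟩, ?_, ?_⟩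
  · rw [Submodule.disjoint_def]
    rintro _ ⟨a, rfl⟩ ha
    have : (Φ ∘ₗ C) a = (Φ ∘ₗ C) 0 := by simpa using ha
    rw [hbij this, map_zero]
  · rw [codisjoint_iff, eq_top_iff]
    intro x _
    obtain ⟨a, ha⟩ := hsurj (Φ x)
    rw [← add_sub_cancel (C a) x]
    refine Submodule.add_mem_sup ⟨a, rfl⟩ ?_
    rw [LinearMap.mem_ker, map_sub, ← ha, LinearMap.comp_apply, sub_self]
  · intro w hw
    -- Powers above `k` vanish, so this holds for every `l`, and the shift from `l` to `l + 1` stays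
    -- inside the conditions defining `W`.
    have hw' (l : ℕ) : φ ((g ^ l) w) = 0 := by
      rcases lt_or_ge k l with h | h
      · rw [hz _ h, map_zero]
      · exact congrFun hw ⟨l, by omega⟩
    rw [LinearMap.mem_ker]
    ext l
    simpa [Φ, pow_succ] using hw' (l + 1)
  · intro i
    simp [C, Fintype.linearCombination_apply, Pi.single_apply]

/-- A nilpotent endomorphism of a finite-dimensional vector space over a division ring has a
Jordan basis. -/
theorem HasJordanBasis.of_isNilpotent [FiniteDimensional D V] (g : V →ₗ[D] V)
    (hg : IsNilpotent g) : HasJordanBasis {(0 : D)} g := by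
  induction hn : Module.finrank D V using Nat.strong_induction_on generalizing V with
  | _ n ih =>
  rcases subsingleton_or_nontrivial V with hV | hV
  · exact .of_subsingleton _ _
  classical
  obtain ⟨k, hk⟩ : ∃ k, nilpotencyClass g = k + 1 :=
    Nat.exists_eq_succ_of_ne_zero (pos_nilpotencyClass_iff.mpr hg).ne'
  have hk0 : g ^ (k + 1) = 0 := hk ▸ pow_nilpotencyClass hg
  have hk1 : g ^ k ≠ 0 := by
    simpa [hk] using pow_pred_nilpotencyClass hg
  obtain ⟨v, hv⟩ : ∃ v, (g ^ k) v ≠ 0 := by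
    by_contra! h
    exact hk1 (LinearMap.ext h)
  obtain ⟨U, W, b, hUW, hW, hb⟩ := exists_cyclic_isCompl g k hk0 v hv
  have hgb (i : Fin (k + 1)) : g (b i) = (g ^ ((i : ℕ) + 1)) v := by
    rw [hb, pow_succ', Module.End.mul_apply]
  have hgbU (i : Fin (k + 1)) : g (b i) = 0 ∨ ∃ j : Fin (k + 1), (j : ℕ) = i + 1 ∧
      g (b i) = b j := by
    rcases lt_or_ge ((i : ℕ) + 1) (k + 1) with h | h
    · exact .inr ⟨⟨i + 1, h⟩, rfl, by rw [hgb, hb]⟩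
    · exact .inl (by rw [hgb, pow_eq_zero_of_le h hk0, LinearMap.zero_apply])
  have hU : ∀ u ∈ U, g u ∈ U := by
    intro u hu
    have : ⊤ ≤ U.comap (g ∘ₗ U.subtype) := by
      rw [← b.span_eq, Submodule.span_le]
      rintro _ ⟨i, rfl⟩
      rcases hgbU i with h | ⟨j, -, h⟩
      · simp [h]
      · simp [h]
    exact this (Submodule.mem_top (x := ⟨u, hu⟩))
  refine .of_isCompl hUW hU hW ?_ ?_
  · refine ⟨k + 1, b, 0, by simp, fun i => ?_⟩
    rcases hgbU i with h | ⟨j, hj, h⟩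
    · exact .inl (Subtype.ext (by simpa using h))
    · exact .inr ⟨j, hj, rfl, Subtype.ext (by simpa using h)⟩
  · have hfin := Submodule.finrank_add_eq_of_isCompl hUW
    have hUk : Module.finrank D U = k + 1 := by simp [Module.finrank_eq_card_basis b]
    refine ih (Module.finrank D W) (by omega) (g.restrict hW) ?_ rfl
    refine ⟨k + 1, ?_⟩
    ext w
    simp [Module.End.pow_restrict, hk0]

theorem exists_basis_of_isNilpotent [FiniteDimensional D V] (g : V →ₗ[D] V)
    (hg : IsNilpotent g) : ∃ (k : ℕ) (b : Module.Basis (Fin k) D V), ∀ i, g (b i) = 0 ∨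
      ∃ j : Fin k, (j : ℕ) = i + 1 ∧ g (b i) = b j := by
  obtain ⟨k, b, c, hc, hb⟩ := HasJordanBasis.of_isNilpotent g hg
  have hc0 (i : Fin k) : c i = 0 := hc i
  refine ⟨k, b, fun i => (hb i).imp (fun h => by simpa [hc0] using h) ?_⟩
  rintro ⟨j, hj, -, h⟩
  exact ⟨j, hj, by simpa [hc0] using h⟩

end DivisionRing

/-! ### Jordan bases of quaternion linear maps. -/

noncomputable section

theorem quatJ_mul_coeComplex (z : ℂ) :
    quatJ * (z : ℍ[ℝ]) = ((starRingEnd ℂ z : ℂ) : ℍ[ℝ]) * quatJ := by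
  have h0 : quatJ.re = 0 := rfl
  have h1 : quatJ.imI = 0 := rfl
  have h2 : quatJ.imJ = 1 := rfl
  have h3 : quatJ.imK = 0 := rfl
  ext <;> simp [h0, h1, h2, h3]

theorem quatJ_mul_quatJ : quatJ * quatJ = -1 := by
  have h0 : quatJ.re = 0 := rfl
  have h1 : quatJ.imI = 0 := rfl
  have h2 : quatJ.imJ = 1 := rfl
  have h3 : quatJ.imK = 0 := rfl
  ext <;> simp [h0, h1, h2, h3]

theorem exists_eq_add_quatJ_mul (h : ℍ[ℝ]) : ∃ a b : ℂ, h = (a : ℍ[ℝ]) + quatJ * (b : ℍ[ℝ]) := by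
  have h0 : quatJ.re = 0 := rfl
  have h1 : quatJ.imI = 0 := rfl
  have h2 : quatJ.imJ = 1 := rfl
  have h3 : quatJ.imK = 0 := rfl
  refine ⟨⟨h.re, h.imI⟩, ⟨h.imJ, -h.imK⟩, ?_⟩
  ext <;> simp [h0, h1, h2, h3]

section

variable {V : Type*} [AddCommGroup V] [Module ℍ[ℝ] V]

theorem quatJ_smul_smul (v : V) : quatJ • quatJ • v = -v := by
  rw [smul_smul, quatJ_mul_quatJ, neg_smul, one_smul]

/-- Multiplication by a real number, as an `ℍ`-linear map. -/
def realScalar (V : Type*) [AddCommGroup V] [Module ℍ[ℝ] V] (r : ℝ) : Module.End ℍ[ℝ] V where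
  toFun v := (r : ℍ[ℝ]) • v
  map_add' := smul_add _
  map_smul' h v := by
    rw [smul_smul, Quaternion.coe_commutes, RingHom.id_apply, smul_smul]

@[simp] theorem realScalar_apply (r : ℝ) (v : V) : realScalar V r v = (r : ℍ[ℝ]) • v := rfl

/-- The value at `f` of the real polynomial with roots `μ` and its conjugate. -/
def realQuadratic (f : Module.End ℍ[ℝ] V) (μ : ℂ) : Module.End ℍ[ℝ] V :=
  f * f - realScalar V (2 * μ.re) * f + realScalar V (Complex.normSq μ)

theorem realQuadratic_apply (f : Module.End ℍ[ℝ] V) (μ : ℂ) (v : V) :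
    realQuadratic f μ v =
      f (f v) - ((2 * μ.re : ℝ) : ℍ[ℝ]) • f v + ((Complex.normSq μ : ℝ) : ℍ[ℝ]) • v := rfl

theorem coe_add_conj (μ : ℂ) :
    ((2 * μ.re : ℝ) : ℍ[ℝ]) = (μ : ℍ[ℝ]) + ((starRingEnd ℂ μ : ℂ) : ℍ[ℝ]) := by
  ext <;> simp [two_mul]

theorem coe_mul_conj (μ : ℂ) :
    ((Complex.normSq μ : ℝ) : ℍ[ℝ]) = (μ : ℍ[ℝ]) * ((starRingEnd ℂ μ : ℂ) : ℍ[ℝ]) := by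
  ext <;> simp [Complex.normSq_apply, mul_comm]

theorem commute_realQuadratic (f : Module.End ℍ[ℝ] V) (μ : ℂ) : Commute f (realQuadratic f μ) := by
  ext v
  simp [realQuadratic_apply]

variable [Module ℂ V] (hc : ∀ (z : ℂ) (v : V), z • v = (z : ℍ[ℝ]) • v)
include hc

theorem quatJ_smul_complex_smul (z : ℂ) (v : V) :
    quatJ • z • v = (starRingEnd ℂ z : ℂ) • quatJ • v := by
  rw [hc, hc, smul_smul, smul_smul, quatJ_mul_coeComplex]

/-- If `s` spans over `ℍ`, then `s ∪ 𝐣s` spans over `ℂ`: its complex span is stable under `𝐣`, and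
`ℍ = ℂ + 𝐣ℂ`. -/
theorem finite_complex_of_finite_quaternion [Module.Finite ℍ[ℝ] V] : Module.Finite ℂ V := by
  classical
  obtain ⟨s, hs⟩ := (Module.Finite.fg_top : (⊤ : Submodule ℍ[ℝ] V).FG)
  let t : Finset V := s ∪ s.image (quatJ • ·)
  have hj : ∀ x ∈ Submodule.span ℂ (t : Set V), quatJ • x ∈ Submodule.span ℂ (t : Set V) := by
    intro x hx
    induction hx using Submodule.span_induction with
    | mem x hx =>
      have hx' : x ∈ s ∨ ∃ y ∈ s, quatJ • y = x := by simpa [t] using hx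
      rcases hx' with h | ⟨y, hy, rfl⟩
      · exact Submodule.subset_span (by simp only [t, Finset.coe_union, Finset.coe_image]
                                        exact Or.inr ⟨x, h, rfl⟩)
      · rw [quatJ_smul_smul]
        exact neg_mem (Submodule.subset_span (by simp [t, hy]))
    | zero => simp
    | add x y _ _ hx hy => rw [smul_add]; exact add_mem hx hy
    | smul z x _ hx =>
      rw [quatJ_smul_complex_smul hc]
      exact Submodule.smul_mem _ _ hx
  refine ⟨⟨t, ?_⟩⟩
  rw [eq_top_iff]
  intro x _
  have hx : x ∈ Submodule.span ℍ[ℝ] (s : Set V) := hs ▸ Submodule.mem_top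
  induction hx using Submodule.span_induction with
  | mem x hx => exact Submodule.subset_span (by simp only [t, Finset.coe_union]; exact Or.inl hx)
  | zero => simp
  | add x y _ _ hx hy => exact add_mem (hx trivial) (hy trivial)
  | smul h x _ hx =>
    obtain ⟨a, b, rfl⟩ := exists_eq_add_quatJ_mul h
    rw [add_smul, mul_smul, ← hc, ← hc]
    exact add_mem (Submodule.smul_mem _ _ (hx trivial))
      (hj _ (Submodule.smul_mem _ _ (hx trivial)))

/-- A quaternion linear map, viewed as a complex linear map. -/
def toComplexEnd (f : Module.End ℍ[ℝ] V) : Module.End ℂ V where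
  toFun := f
  map_add' := map_add f
  map_smul' z v := by rw [hc, map_smul, RingHom.id_apply, hc]

/-- If `v` is an eigenvector for `μ`, then `𝐣v` is one for the conjugate of `μ`, so the sign of the
imaginary part can be chosen. -/
theorem exists_eigenvector_im_nonneg [Module.Finite ℍ[ℝ] V] [Nontrivial V]
    (f : Module.End ℍ[ℝ] V) :
    ∃ (μ : ℂ) (v : V), 0 ≤ μ.im ∧ v ≠ 0 ∧ f v = (μ : ℍ[ℝ]) • v := by
  have := finite_complex_of_finite_quaternion hc
  obtain ⟨μ, hμ⟩ := Module.End.exists_eigenvalue (toComplexEnd hc f)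
  obtain ⟨v, hv⟩ := hμ.exists_hasEigenvector
  have hfv : f v = μ • v := hv.apply_eq_smul
  rcases le_total 0 μ.im with h | h
  · exact ⟨μ, v, h, hv.2, by rw [hfv, hc]⟩
  · refine ⟨starRingEnd ℂ μ, quatJ • v, by simpa using h, ?_, ?_⟩
    · intro h0
      have := quatJ_smul_smul v
      rw [h0, smul_zero, eq_comm, neg_eq_zero] at this
      exact hv.2 this
    · rw [map_smul, hfv, quatJ_smul_complex_smul hc, hc]

theorem toComplexEnd_sub_mul (f : Module.End ℍ[ℝ] V) (μ : ℂ) :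
    (toComplexEnd hc f - algebraMap ℂ _ μ) * (toComplexEnd hc f - algebraMap ℂ _ (starRingEnd ℂ μ)) =
      toComplexEnd hc (realQuadratic f μ) := by
  ext v
  have h : toComplexEnd hc (realQuadratic f μ) v = realQuadratic f μ v := rfl
  have h' (v : V) : toComplexEnd hc f v = f v := rfl
  rw [h, realQuadratic_apply, coe_add_conj, coe_mul_conj]
  simp only [Module.End.mul_apply, LinearMap.sub_apply, Module.algebraMap_end_apply, h', map_sub,
    add_smul, mul_smul, hc, map_smul]
  abel

theorem toComplexEnd_pow (f : Module.End ℍ[ℝ] V) (m : ℕ) :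
    toComplexEnd hc f ^ m = toComplexEnd hc (f ^ m) := by
  ext v
  change _ = (f ^ m) v
  rw [Module.End.pow_apply, Module.End.pow_apply]
  rfl

/-- Multiplication by `𝐣` is antilinear and commutes with `f`, so it exchanges the generalized
eigenspaces of `μ` and its conjugate. -/
theorem quatJ_smul_pow_apply (f : Module.End ℍ[ℝ] V) (μ : ℂ) (m : ℕ) (v : V) :
    quatJ • (((toComplexEnd hc f - algebraMap ℂ _ μ) ^ m) v) =
      ((toComplexEnd hc f - algebraMap ℂ _ (starRingEnd ℂ μ)) ^ m) (quatJ • v) := by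
  have h' (v : V) : toComplexEnd hc f v = f v := rfl
  induction m generalizing v with
  | zero => simp
  | succ m ih =>
    rw [pow_succ, pow_succ, Module.End.mul_apply, ih, Module.End.mul_apply]
    congr 1
    simp only [LinearMap.sub_apply, h', Module.algebraMap_end_apply, smul_sub, map_smul,
      quatJ_smul_complex_smul hc]

/-- For nonreal `μ` the two linear factors of the real quadratic are coprime. -/
theorem isCompl_ker_pow (f : Module.End ℍ[ℝ] V) (μ : ℂ) (hμ : μ.im ≠ 0) (m : ℕ)
    (hm : realQuadratic f μ ^ m = 0) :
    IsCompl (LinearMap.ker ((toComplexEnd hc f - algebraMap ℂ _ μ) ^ m))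
      (LinearMap.ker ((toComplexEnd hc f - algebraMap ℂ _ (starRingEnd ℂ μ)) ^ m)) := by
  open Polynomial in
  have hne : μ ≠ starRingEnd ℂ μ := fun h => hμ (Complex.conj_eq_iff_im.mp h.symm)
  have hcop : IsCoprime ((X - C μ) ^ m) ((X - C (starRingEnd ℂ μ)) ^ m) :=
    (isCoprime_X_sub_C_of_isUnit_sub (sub_ne_zero.mpr hne).isUnit).pow
  have ha (z : ℂ) : aeval (toComplexEnd hc f) ((X - C z) ^ m) =
      (toComplexEnd hc f - algebraMap ℂ _ z) ^ m := by simp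
  rw [← ha, ← ha]
  refine ⟨disjoint_ker_aeval_of_isCoprime _ hcop, codisjoint_iff.mpr ?_⟩
  rw [sup_ker_aeval_eq_ker_aeval_mul_of_coprime _ hcop, ← mul_pow, map_pow, map_mul]
  have : aeval (toComplexEnd hc f) (X - C μ) * aeval (toComplexEnd hc f) (X - C (starRingEnd ℂ μ)) =
      toComplexEnd hc (realQuadratic f μ) := by
    rw [← toComplexEnd_sub_mul]; simp
  rw [this, toComplexEnd_pow, hm]
  exact LinearMap.ker_zero

omit hc
/-- The quaternions that are complex numbers with nonnegative imaginary part. -/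
def closedUpperHalf : Set ℍ[ℝ] := {h | ∃ μ : ℂ, 0 ≤ μ.im ∧ (μ : ℍ[ℝ]) = h}
include hc

/-- A complex Jordan basis of `g = f - μ` on `E` is also an `ℍ`-basis of `V`, because `V = E ⊕ E'`
and `𝐣` exchanges the summands. -/
theorem hasJordanBasis_of_im_pos [Module.Finite ℍ[ℝ] V] (f : Module.End ℍ[ℝ] V) (μ : ℂ)
    (hμ : 0 < μ.im) (m : ℕ) (hm : realQuadratic f μ ^ m = 0) :
    HasJordanBasis closedUpperHalf f := by
  have := finite_complex_of_finite_quaternion hc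
  have hcompl := isCompl_ker_pow hc f μ hμ.ne' m hm
  set g := toComplexEnd hc f - algebraMap ℂ _ μ with hg
  set E := LinearMap.ker (g ^ m) with hE
  set E' := LinearMap.ker ((toComplexEnd hc f - algebraMap ℂ _ (starRingEnd ℂ μ)) ^ m) with hE'
  have hEE' (v : V) (hv : v ∈ E) : quatJ • v ∈ E' := by
    rw [hE', LinearMap.mem_ker, ← quatJ_smul_pow_apply, LinearMap.mem_ker.mp hv, smul_zero]
  have hE'E (v : V) (hv : v ∈ E') : quatJ • v ∈ E := by
    have h := quatJ_smul_pow_apply hc f (starRingEnd ℂ μ) m v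
    rw [LinearMap.mem_ker.mp hv, smul_zero, Complex.conj_conj] at h
    exact h.symm
  have hgE : ∀ v ∈ E, g v ∈ E := by
    intro v hv
    rw [hE, LinearMap.mem_ker, ← Module.End.mul_apply, ← pow_succ, pow_succ', Module.End.mul_apply,
      LinearMap.mem_ker.mp hv, map_zero]
  obtain ⟨k, b, hb⟩ := exists_basis_of_isNilpotent (g.restrict hgE) ⟨m, by
    ext v
    rw [Module.End.pow_restrict]
    exact v.2⟩
  have hfg (v : V) : f v = (μ : ℍ[ℝ]) • v + g v := by
    have h' : toComplexEnd hc f v = f v := rfl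
    rw [← hc, hg, LinearMap.sub_apply, h', Module.algebraMap_end_apply, add_sub_cancel]
  have hli : LinearIndependent ℍ[ℝ] fun i => (b i : V) := by
    rw [Fintype.linearIndependent_iff]
    intro h hsum i
    -- Split the coefficients as `α + 𝐣β`: the `α`-part of the relation lies in `E` and the
    -- `𝐣β`-part in `E'`, so both vanish.
    choose α β hαβ using fun i => exists_eq_add_quatJ_mul (h i)
    have hmem (γ : Fin k → ℂ) : ∑ i, γ i • (b i : V) ∈ E :=
      sum_mem fun i _ => Submodule.smul_mem _ _ (b i).2
    have hadd : (∑ i, α i • (b i : V)) + quatJ • ∑ i, β i • (b i : V) = 0 := by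
      rw [← hsum, Finset.smul_sum, ← Finset.sum_add_distrib]
      refine Finset.sum_congr rfl fun i _ => ?_
      rw [hαβ, add_smul, mul_smul, hc, hc]
    have hzero (γ : Fin k → ℂ) (h0 : ∑ i, γ i • (b i : V) = 0) (i : Fin k) : γ i = 0 := by
      refine Fintype.linearIndependent_iff.mp b.linearIndependent γ (Subtype.ext ?_) i
      simpa using h0
    have hα : ∑ i, α i • (b i : V) = 0 := by
      refine Submodule.disjoint_def.mp hcompl.disjoint _ (hmem α) ?_
      rw [eq_neg_of_add_eq_zero_left hadd]
      exact neg_mem (hEE' _ (hmem β))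
    have hβ : ∑ i, β i • (b i : V) = 0 := by
      rw [hα, zero_add] at hadd
      rw [← neg_eq_zero, ← quatJ_smul_smul, hadd, smul_zero]
    rw [hαβ, hzero α hα, hzero β hβ]
    simp
  have hspanE (v : V) (hv : v ∈ E) : v ∈ Submodule.span ℍ[ℝ] (Set.range fun i => (b i : V)) := by
    have := congrArg Subtype.val (b.sum_repr ⟨v, hv⟩)
    simp only [AddSubmonoidClass.coe_finsetSum, Submodule.coe_smul, hc] at this
    rw [← this]
    exact sum_mem fun i _ => Submodule.smul_mem _ _ (Submodule.subset_span ⟨i, rfl⟩)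
  have hspan : ⊤ ≤ Submodule.span ℍ[ℝ] (Set.range fun i => (b i : V)) := by
    intro v _
    obtain ⟨e, he, e', he', rfl⟩ := Submodule.mem_sup.mp
      (hcompl.sup_eq_top ▸ Submodule.mem_top : v ∈ E ⊔ E')
    refine add_mem (hspanE e he) ?_
    rw [← neg_neg e', ← quatJ_smul_smul e']
    exact neg_mem (Submodule.smul_mem _ _ (hspanE _ (hE'E e' he')))
  refine ⟨k, Module.Basis.mk hli hspan, fun _ => μ, fun _ => ⟨μ, hμ.le, rfl⟩, fun i => ?_⟩
  simp only [Module.Basis.mk_apply]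
  rw [hfg]
  refine Or.imp (fun h => ?_) ?_ (hb i)
  · have : g (b i) = 0 := by simpa using congrArg Subtype.val h
    rw [this, add_zero]
  · rintro ⟨j, hj, h⟩
    have : g (b i) = b j := by simpa using congrArg Subtype.val h
    exact ⟨j, hj, trivial, by rw [this]⟩

omit hc [Module ℂ V]

/-- For real `μ` the quadratic is the square of the `ℍ`-linear map `f - μ`, which is therefore
nilpotent. -/
theorem hasJordanBasis_of_real [Module.Finite ℍ[ℝ] V] (f : Module.End ℍ[ℝ] V) (μ : ℂ)
    (hμ : μ.im = 0) (m : ℕ) (hm : realQuadratic f μ ^ m = 0) :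
    HasJordanBasis closedUpperHalf f := by
  have hsq : realQuadratic f μ = (f - realScalar V μ.re) ^ 2 := by
    ext v
    rw [realQuadratic_apply, Complex.normSq_apply, hμ, pow_two]
    simp only [Module.End.mul_apply, LinearMap.sub_apply, map_sub, realScalar_apply, map_smul,
      smul_sub, smul_smul, two_mul, Quaternion.coe_add, add_smul, mul_zero, add_zero,
      Quaternion.coe_mul]
    abel
  obtain ⟨k, b, hb⟩ := exists_basis_of_isNilpotent (f - realScalar V μ.re)
    ⟨2 * m, by rw [pow_mul, ← hsq, hm]⟩
  have hfg (v : V) : f v = ((μ.re : ℂ) : ℍ[ℝ]) • v + (f - realScalar V μ.re) v := by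
    simp
  refine ⟨k, b, fun _ => ((μ.re : ℂ) : ℍ[ℝ]), fun _ => ⟨_, by simp, rfl⟩, fun i => ?_⟩
  rw [hfg]
  refine (hb i).imp (fun h => by rw [h, add_zero]) ?_
  rintro ⟨j, hj, h⟩
  exact ⟨j, hj, rfl, by rw [h]⟩

/-- Jordan bases of quaternion linear maps. -/
theorem hasJordanBasis_quaternion [Module.Finite ℍ[ℝ] V] (f : Module.End ℍ[ℝ] V) :
    HasJordanBasis closedUpperHalf f := by
  induction hn : Module.finrank ℍ[ℝ] V using Nat.strong_induction_on generalizing V with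
  | _ n ih =>
  rcases subsingleton_or_nontrivial V with hV | hV
  · exact .of_subsingleton _ _
  let _ : Module ℂ V := Module.compHom V Quaternion.ofComplex.toRingHom
  obtain ⟨μ, v, hμ, hv, hfv⟩ := exists_eigenvector_im_nonneg (fun _ _ => rfl) f
  have hpv : realQuadratic f μ v = 0 := by
    have hz : (μ : ℍ[ℝ]) * μ - ((μ : ℍ[ℝ]) + (starRingEnd ℂ μ : ℂ)) * μ +
        μ * (starRingEnd ℂ μ : ℂ) = 0 := by
      rw [← Quaternion.coeComplex_mul, ← Quaternion.coeComplex_mul, mul_comm μ (starRingEnd ℂ μ),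
        Quaternion.coeComplex_mul, Quaternion.coeComplex_mul]
      noncomm_ring
    rw [realQuadratic_apply, coe_add_conj, coe_mul_conj, hfv, map_smul, hfv, smul_smul, smul_smul,
      ← sub_smul, ← add_smul, hz, zero_smul]
  -- Fitting's decomposition. The condition `1 ≤ m` places `v` in the kernel, so the range has
  -- smaller dimension and the induction applies to it.
  obtain ⟨m, hm, hm1⟩ := ((realQuadratic f μ).eventually_isCompl_ker_pow_range_pow.and
    (Filter.eventually_ge_atTop 1)).exists
  have hcomm := (commute_realQuadratic f μ).pow_right m
  have hcomm' (v : V) : f ((realQuadratic f μ ^ m) v) = (realQuadratic f μ ^ m) (f v) :=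
    LinearMap.congr_fun hcomm v
  have hU : ∀ u ∈ LinearMap.ker (realQuadratic f μ ^ m),
      f u ∈ LinearMap.ker (realQuadratic f μ ^ m) := by
    intro u hu
    rw [LinearMap.mem_ker, ← hcomm', LinearMap.mem_ker.mp hu, map_zero]
  have hW : ∀ u ∈ LinearMap.range (realQuadratic f μ ^ m),
      f u ∈ LinearMap.range (realQuadratic f μ ^ m) := by
    rintro _ ⟨w, rfl⟩
    exact ⟨f w, (hcomm' w).symm⟩
  refine .of_isCompl hm hU hW ?_ ?_
  · have hzero : realQuadratic (f.restrict hU) μ ^ m = 0 := by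
      have h (j : ℕ) (u : LinearMap.ker (realQuadratic f μ ^ m)) :
          (((realQuadratic (f.restrict hU) μ ^ j) u : _) : V) = (realQuadratic f μ ^ j) u := by
        induction j generalizing u with
        | zero => rfl
        | succ j ih =>
          rw [pow_succ, pow_succ, Module.End.mul_apply, Module.End.mul_apply, ih]
          rfl
      ext u
      rw [h]
      exact u.2
    rcases hμ.eq_or_lt with h | h
    · exact hasJordanBasis_of_real _ μ h.symm m hzero
    · let _ : Module ℂ (LinearMap.ker (realQuadratic f μ ^ m)) :=
        Module.compHom _ Quaternion.ofComplex.toRingHom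
      exact hasJordanBasis_of_im_pos (V := LinearMap.ker (realQuadratic f μ ^ m)) (fun _ _ => rfl)
        _ μ h m hzero
  · have hfin := Submodule.finrank_add_eq_of_isCompl hm
    have hpos : 0 < Module.finrank ℍ[ℝ] (LinearMap.ker (realQuadratic f μ ^ m)) := by
      have : Nontrivial (LinearMap.ker (realQuadratic f μ ^ m)) := by
        refine ⟨⟨v, ?_⟩, 0, fun h => hv (congrArg Subtype.val h)⟩
        obtain ⟨j, rfl⟩ := Nat.exists_eq_add_of_le' hm1
        rw [LinearMap.mem_ker, pow_succ, Module.End.mul_apply, hpv, map_zero]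
      exact Module.finrank_pos
    exact ih (Module.finrank ℍ[ℝ] (LinearMap.range (realQuadratic f μ ^ m))) (by omega) _ rfl

end
end

/-! ### Right eigenvalues and Jordan forms of quaternion matrices. -/

noncomputable section

theorem coe_add_quatJ_mul_injective {a b a' b' : ℂ}
    (h : (a : ℍ[ℝ]) + quatJ * b = (a' : ℍ[ℝ]) + quatJ * b') : a = a' ∧ b = b' := by
  have h0 : quatJ.re = 0 := rfl
  have h1 : quatJ.imI = 0 := rfl
  have h2 : quatJ.imJ = 1 := rfl
  have h3 : quatJ.imK = 0 := rfl
  have h := QuaternionAlgebra.ext_iff.mp h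
  simp [h0, h1, h2, h3] at h
  exact ⟨Complex.ext h.1 h.2.1, Complex.ext h.2.2.1 h.2.2.2⟩

theorem coeComplex_sum {ι : Type*} (s : Finset ι) (f : ι → ℂ) :
    ((∑ i ∈ s, f i : ℂ) : ℍ[ℝ]) = ∑ i ∈ s, (f i : ℍ[ℝ]) :=
  map_sum Quaternion.ofComplex f s

theorem exists_mulVec_eq_smul_iff_of_upperTriangular {n : ℕ} {K : Matrix (Fin n) (Fin n) ℂ}
    (hK : ∀ i k, k < i → K i k = 0) (μ : ℂ) :
    (∃ v, v ≠ 0 ∧ K *ᵥ v = μ • v) ↔ ∃ i, K i i = μ := by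
  have htri : (K - Matrix.scalar (Fin n) μ).BlockTriangular id := by
    intro i k hik
    have : i ≠ k := fun h => by simp [h] at hik
    simp [hK i k hik, this]
  have h := Matrix.exists_mulVec_eq_zero_iff (M := K - Matrix.scalar (Fin n) μ)
  rw [Matrix.det_of_isUpperTriangular htri, Finset.prod_eq_zero_iff] at h
  simpa [Matrix.sub_mulVec, sub_eq_zero] using h

theorem isRightEigenvalue_conj {n : ℕ} {A J P Q : Matrix (Fin n) (Fin n) ℍ[ℝ]}
    (hQP : Q * P = 1) (hA : A = P * J * Q) {μ : ℍ[ℝ]} (h : IsRightEigenvalue J μ) :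
    IsRightEigenvalue A μ := by
  obtain ⟨x, hx, hJ⟩ := h
  refine ⟨P *ᵥ x, fun h0 => hx ?_, ?_⟩
  · rw [← Matrix.one_mulVec x, ← hQP, ← Matrix.mulVec_mulVec, h0, Matrix.mulVec_zero]
  · rw [hA, Matrix.mulVec_mulVec, Matrix.mul_assoc, hQP, Matrix.mul_one, ← Matrix.mulVec_mulVec, hJ]
    ext1 i
    simp [Matrix.mulVec, dotProduct, Finset.sum_mul, mul_assoc]

/-- Writing `x = u + 𝐣w`, the equation `K x = x μ` separates into `K u = μ u` and `conj(K) w = μ w`.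
-/
theorem isRightEigenvalue_toQuat_iff {n : ℕ} {K : Matrix (Fin n) (Fin n) ℂ}
    (hK : ∀ i k, k < i → K i k = 0) (him : ∀ i, 0 ≤ (K i i).im) (μ : ℂ) :
    (∃ i, K i i = μ) ↔ (0 ≤ μ.im ∧ IsRightEigenvalue (toQuat K) (μ : ℍ[ℝ])) := by
  constructor
  · intro h
    refine ⟨by obtain ⟨i, rfl⟩ := h; exact him i, ?_⟩
    obtain ⟨v, hv, hKv⟩ := (exists_mulVec_eq_smul_iff_of_upperTriangular hK μ).mpr h
    refine ⟨fun i => (v i : ℍ[ℝ]), fun h0 => hv ?_, ?_⟩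
    · ext1 i
      have := congrFun h0 i
      exact (map_eq_zero Quaternion.ofComplex).mp this
    · ext1 i
      rw [← Quaternion.coeComplex_mul, mul_comm, ← smul_eq_mul, ← Pi.smul_apply, ← hKv]
      simp [Matrix.mulVec, dotProduct, toQuat, coeComplex_sum, Quaternion.coeComplex_mul]
  · rintro ⟨hμ, x, hx, hKx⟩
    choose u w huw using fun i => exists_eq_add_quatJ_mul (x i)
    have hrow (i : Fin n) : (K *ᵥ u) i = (μ • u) i ∧
        (K.map (starRingEnd ℂ) *ᵥ w) i = (μ • w) i := by
      apply coe_add_quatJ_mul_injective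
      have h := congrFun hKx i
      simp only [Matrix.mulVec, dotProduct, toQuat, huw, Matrix.map_apply, mul_add,
        Finset.sum_add_distrib, add_mul] at h
      simp only [Matrix.mulVec, dotProduct, coeComplex_sum, Finset.mul_sum, Pi.smul_apply,
        smul_eq_mul, Quaternion.coeComplex_mul, Matrix.map_apply]
      simp only [← mul_assoc, quatJ_mul_coeComplex, Complex.conj_conj]
      simp only [← mul_assoc] at h
      rw [h, ← Quaternion.coeComplex_mul, ← Quaternion.coeComplex_mul, mul_comm (u i), mul_assoc quatJ,
        ← Quaternion.coeComplex_mul, mul_comm (w i), Quaternion.coeComplex_mul,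
        Quaternion.coeComplex_mul, ← mul_assoc quatJ, quatJ_mul_coeComplex]
    by_cases hu : u = 0
    · have hw : w ≠ 0 := by
        rintro rfl
        apply hx
        ext1 i
        rw [huw, hu]
        simp
      obtain ⟨i, hi⟩ := (exists_mulVec_eq_smul_iff_of_upperTriangular
        (K := K.map (starRingEnd ℂ)) (fun i k h => by simp [hK i k h]) μ).mp
        ⟨w, hw, funext fun i => (hrow i).2⟩
      refine ⟨i, ?_⟩
      have h1 := him i
      -- Here `μ` is the conjugate of `K i i` and both have nonnegative imaginary part, so both are
      -- real.
      have h0 : (K i i).im = 0 := by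
        have : -(K i i).im = μ.im := by simp [← hi]
        linarith
      rw [← hi, Matrix.map_apply, Complex.conj_eq_iff_im.mpr h0]
    · exact (exists_mulVec_eq_smul_iff_of_upperTriangular hK μ).mp
        ⟨u, hu, funext fun i => (hrow i).1⟩

/-- Every quaternion matrix has a Jordan canonical form. -/
theorem exists_isQuatJordanForm {n : ℕ} (A : Matrix (Fin n) (Fin n) ℍ[ℝ]) :
    ∃ J, IsQuatJordanForm A J ∧ ∀ i k, k < i → J i k = 0 := by
  classical
  -- `A` acts on row vectors from the right, which is linear for left scalars. The Jordan basis thus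
  -- forms the rows of `P`, and `P A = K P` puts the ones on the superdiagonal.
  obtain ⟨f, hf⟩ : ∃ f, f = Matrix.toLinearMapRight' A := ⟨_, rfl⟩
  obtain ⟨k, b, c, hc, hb⟩ := hasJordanBasis_quaternion f
  obtain rfl : k = n := by
    simpa using (Module.finrank_eq_card_basis b).symm
  choose γ hγ hγc using hc
  let K : Matrix (Fin k) (Fin k) ℂ := fun i j => if j = i then γ i else
    if (j : ℕ) = i + 1 ∧ f (b i) ≠ c i • b i then 1 else 0
  let P : Matrix (Fin k) (Fin k) ℍ[ℝ] := Matrix.of fun i => b i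
  let Q : Matrix (Fin k) (Fin k) ℍ[ℝ] := Matrix.of fun i => b.repr (Pi.single i 1)
  have hQP : Q * P = 1 := by
    ext1 i l
    have := congrFun (b.sum_repr (Pi.single i 1)) l
    simpa [Q, P, Matrix.mul_apply, Matrix.one_apply, Pi.single_apply, eq_comm] using this
  have hPQ : P * Q = 1 := mul_eq_one_comm.mp hQP
  have hrow (i : Fin k) : f (b i) = ∑ j, (K i j : ℍ[ℝ]) • b j := by
    have hKi : (K i i : ℍ[ℝ]) = c i := by simp [K, hγc]
    by_cases h : f (b i) = c i • b i
    · rw [Finset.sum_eq_single i, h, hKi]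
      · intro j _ hj
        simp [K, hj, h]
      · simp
    · obtain ⟨j, hj, -, hAj⟩ := (hb i).resolve_left h
      have hij : j ≠ i := by rintro rfl; omega
      have hKj : (K i j : ℍ[ℝ]) = 1 := by simp [K, hij, hj, h]
      rw [← Finset.sum_subset (Finset.subset_univ {i, j}), Finset.sum_pair hij.symm, hAj, hKi, hKj,
        one_smul]
      intro l _ hl
      have hl' : l ≠ i ∧ l ≠ j := by simpa using hl
      have : (l : ℕ) ≠ i + 1 := fun h => hl'.2 (Fin.ext (h.trans hj.symm))
      simp [K, hl'.1, this]
  have hPA : P * A = toQuat K * P := by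
    ext1 i l
    have := congrFun (hrow i) l
    rw [hf] at this
    simpa [P, toQuat, Matrix.mul_apply, Matrix.vecMul, dotProduct] using this
  have hA : A = Q * toQuat K * P := by
    rw [Matrix.mul_assoc, ← hPA, ← Matrix.mul_assoc, hQP, Matrix.one_mul]
  have hJ : toQuat K = P * A * Q := by
    rw [hPA, Matrix.mul_assoc, hPQ, Matrix.mul_one]
  have htri : ∀ i l, l < i → K i l = 0 := by
    intro i l hil
    have h1 : l ≠ i := hil.ne
    have h2 : (l : ℕ) ≠ i + 1 := by omega
    simp [K, h1, h2]
  have hdiag (i : Fin k) : K i i = γ i := by simp [K]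
  refine ⟨toQuat K, ⟨⟨K, ⟨?_, ?_⟩, rfl, fun μ => ?_⟩, Q, P, hQP, hPQ, hA⟩, fun i l h => ?_⟩
  · intro i l h1 h2
    simp [K, h1, h2]
  · intro i l hl
    have h1 : l ≠ i := by rintro rfl; omega
    by_cases h : f (b i) = c i • b i
    · left
      simp [K, h1, h]
    · right
      obtain ⟨j, hj, hcj, -⟩ := (hb i).resolve_left h
      obtain rfl : l = j := Fin.ext (hl.trans hj.symm)
      refine ⟨by simp [K, h1, hl, h], ?_⟩
      rw [hdiag, hdiag]
      apply RingHom.injective Quaternion.ofComplex.toRingHom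
      exact (hγc i).trans (hcj.symm.trans (hγc l).symm)
  · rw [isRightEigenvalue_toQuat_iff htri fun i => hdiag i ▸ hγ i]
    exact and_congr_right fun _ =>
      ⟨isRightEigenvalue_conj hPQ hA, isRightEigenvalue_conj hQP hJ⟩
  · simp [toQuat, htri i l h]

end

/-! ### The Fourier transform of the QT-product. -/

noncomputable section

/-- The unnormalized discrete Fourier matrix. -/
def dftChar (N : ℕ) : Matrix (Fin N) (Fin N) ℂ :=
  fun s t => Complex.exp (-(2 * Real.pi * Complex.I) / N) ^ ((s : ℕ) * (t : ℕ))

/-- Mixing the frontal slices of a tensor by a complex matrix. -/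
def mixSlices {N n₁ n₂ : ℕ} (M : Matrix (Fin N) (Fin N) ℂ) (A : Tensor3 ℍ[ℝ] n₁ n₂ N) :
    Tensor3 ℍ[ℝ] n₁ n₂ N :=
  fun s => ∑ r, (M s r : ℍ[ℝ]) • A r

section

variable {N : ℕ}

theorem mixSlices_apply {n₁ n₂ : ℕ} (M : Matrix (Fin N) (Fin N) ℂ) (A : Tensor3 ℍ[ℝ] n₁ n₂ N)
    (s : Fin N) (i : Fin n₁) (k : Fin n₂) :
    mixSlices M A s i k = ∑ r, (M s r : ℍ[ℝ]) * A r i k := by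
  simp [mixSlices, Matrix.sum_apply]

theorem mixSlices_mixSlices {n₁ n₂ : ℕ} (M L : Matrix (Fin N) (Fin N) ℂ)
    (A : Tensor3 ℍ[ℝ] n₁ n₂ N) : mixSlices M (mixSlices L A) = mixSlices (M * L) A := by
  funext s
  ext1 i k
  simp only [mixSlices_apply, Matrix.mul_apply, coeComplex_sum, Finset.sum_mul, Finset.mul_sum,
    Quaternion.coeComplex_mul, mul_assoc]
  exact Finset.sum_comm

theorem mixSlices_one {n₁ n₂ : ℕ} (A : Tensor3 ℍ[ℝ] n₁ n₂ N) : mixSlices 1 A = A := by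
  funext s
  ext1 i k
  rw [mixSlices_apply, Finset.sum_eq_single s]
  · simp
  · intro r _ hr
    simp [Matrix.one_apply_ne hr.symm]
  · simp

variable [NeZero N]

theorem dftRoot_pow_self : Complex.exp (-(2 * Real.pi * Complex.I) / N) ^ N = 1 := by
  rw [neg_div, Complex.exp_neg, inv_pow,
    (Complex.isPrimitiveRoot_exp N (NeZero.ne N)).pow_eq_one, inv_one]

theorem dftRoot_isPrimitiveRoot :
    IsPrimitiveRoot (Complex.exp (-(2 * Real.pi * Complex.I) / N)) N := by
  rw [neg_div, Complex.exp_neg]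
  exact (Complex.isPrimitiveRoot_exp N (NeZero.ne N)).inv

/-- Addition in `Fin N` wraps around, which is harmless because `ω ^ N = 1`. -/
theorem dftChar_add (s t u : Fin N) : dftChar N s (t + u) = dftChar N s t * dftChar N s u := by
  rw [dftChar, dftChar, dftChar, ← pow_add, ← mul_add, Fin.val_add]
  rw [pow_mul, pow_mul, ← pow_eq_pow_mod]
  rw [← pow_mul, mul_comm (s : ℕ), pow_mul, dftRoot_pow_self, one_pow]

theorem conj_dftChar_mul_self (s t : Fin N) :
    starRingEnd ℂ (dftChar N s t) * dftChar N s t = 1 := by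
  rw [← Complex.normSq_eq_conj_mul_self, Complex.normSq_eq_norm_sq, dftChar, norm_pow,
    dftRoot_isPrimitiveRoot.norm'_eq_one (NeZero.ne N)]
  simp

theorem dftChar_sub (s t u : Fin N) :
    dftChar N s (t - u) = dftChar N s t * starRingEnd ℂ (dftChar N s u) := by
  conv_rhs => rw [← sub_add_cancel t u, dftChar_add, mul_assoc, mul_comm (dftChar N s u),
    conj_dftChar_mul_self, mul_one]

/-- An off-diagonal entry is a geometric sum whose ratio is an `N`-th root of unity other than `1`.
-/
theorem dftChar_mul_conjTranspose : dftChar N * (dftChar N)ᴴ = (N : ℂ) • 1 := by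
  ext s s'
  have hz (t : Fin N) : dftChar N s t * (dftChar N)ᴴ t s' =
      (Complex.exp (-(2 * Real.pi * Complex.I) / N) ^ (s : ℕ) *
        (Complex.exp (-(2 * Real.pi * Complex.I) / N) ^ (s' : ℕ))⁻¹) ^ (t : ℕ) := by
    have : starRingEnd ℂ (dftChar N s' t) = (dftChar N s' t)⁻¹ :=
      eq_inv_of_mul_eq_one_left (conj_dftChar_mul_self s' t)
    rw [Matrix.conjTranspose_apply, ← starRingEnd_apply, this, dftChar, dftChar, mul_pow, inv_pow,
      pow_mul, pow_mul]
  have hne (m : ℕ) : Complex.exp (-(2 * Real.pi * Complex.I) / N) ^ m ≠ 0 :=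
    pow_ne_zero _ (Complex.exp_ne_zero _)
  rw [Matrix.mul_apply, Finset.sum_congr rfl fun t _ => hz t]
  by_cases h : s = s'
  · subst h
    simp
  · rw [Fin.sum_univ_eq_sum_range
      (fun t => (Complex.exp (-(2 * Real.pi * Complex.I) / N) ^ (s : ℕ) *
        (Complex.exp (-(2 * Real.pi * Complex.I) / N) ^ (s' : ℕ))⁻¹) ^ t) N, geom_sum_eq]
    · rw [mul_pow, inv_pow, ← pow_mul, ← pow_mul, mul_comm (s : ℕ), mul_comm (s' : ℕ), pow_mul,
        pow_mul, dftRoot_pow_self]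
      simp [h]
    · intro h1
      rw [mul_inv_eq_one₀ (hne _)] at h1
      exact h (Fin.ext (dftRoot_isPrimitiveRoot.pow_inj s.2 s'.2 h1))

/-- The inverse of the unnormalized discrete Fourier matrix. -/
def dftCharInv (N : ℕ) : Matrix (Fin N) (Fin N) ℂ := (N : ℂ)⁻¹ • (dftChar N)ᴴ

theorem dftChar_mul_inv : dftChar N * dftCharInv N = 1 := by
  have : (N : ℂ) ≠ 0 := Nat.cast_ne_zero.mpr (NeZero.ne N)
  rw [dftCharInv, Matrix.mul_smul, dftChar_mul_conjTranspose, smul_smul, inv_mul_cancel₀ this,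
    one_smul]

omit [NeZero N] in
theorem dftMatrix_eq : dftMatrix N = (((Real.sqrt N)⁻¹ : ℝ) : ℂ) • dftChar N := by
  ext s t
  simp [dftMatrix, dftChar]

theorem dftMatrix_mul_conjTranspose : dftMatrix N * (dftMatrix N)ᴴ = 1 := by
  have h : (N : ℝ) ≠ 0 := Nat.cast_ne_zero.mpr (NeZero.ne N)
  rw [dftMatrix_eq, Matrix.conjTranspose_smul, Matrix.smul_mul, Matrix.mul_smul,
    dftChar_mul_conjTranspose, smul_smul, smul_smul, ← starRingEnd_apply, Complex.conj_ofReal,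
    ← Complex.ofReal_mul, ← mul_inv, Real.mul_self_sqrt (Nat.cast_nonneg N), ← Complex.ofReal_natCast,
    ← Complex.ofReal_mul, inv_mul_cancel₀ h, Complex.ofReal_one, one_smul]

/-- The blocks of the Fourier block diagonalization of `bcircZ A`. -/
def dftSlices {n₁ n₂ : ℕ} (A : Tensor3 ℍ[ℝ] n₁ n₂ N) : Tensor3 ℍ[ℝ] n₁ n₂ N :=
  mixSlices (dftChar N) A

theorem dftSlices_mixSlices_inv {n₁ n₂ : ℕ} (A : Tensor3 ℍ[ℝ] n₁ n₂ N) :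
    dftSlices (mixSlices (dftCharInv N) A) = A := by
  rw [dftSlices, mixSlices_mixSlices, dftChar_mul_inv, mixSlices_one]

theorem dftSlices_injective {n₁ n₂ : ℕ} :
    Function.Injective (dftSlices : Tensor3 ℍ[ℝ] n₁ n₂ N → Tensor3 ℍ[ℝ] n₁ n₂ N) := by
  refine Function.LeftInverse.injective (g := mixSlices (dftCharInv N)) fun A => ?_
  rw [dftSlices, mixSlices_mixSlices, mul_eq_one_comm.mp dftChar_mul_inv, mixSlices_one]

theorem bcircZ_apply {n₁ n₂ : ℕ} (A : Tensor3 ℍ[ℝ] n₁ n₂ N) (p : Fin N × Fin n₁)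
    (q : Fin N × Fin n₂) :
    bcircZ A p q = (partD A (p.1 - q.1) p.2 q.2 : ℍ[ℝ]) +
      quatJ * (partC A (p.1 + q.1) p.2 q.2 : ℍ[ℝ]) := by
  have h : (bcirc (partC A) * (flipPerm N ⊗ₖ (1 : Matrix (Fin n₂) (Fin n₂) ℂ))) p q =
      partC A (p.1 + q.1) p.2 q.2 := by
    rw [Matrix.mul_apply, Finset.sum_eq_single (-q.1, q.2)]
    · simp [bcirc, flipPerm]
    · rintro ⟨u, l⟩ _ hul
      by_cases hl : l = q.2
      · have hu : ¬ u + q.1 = 0 := fun h0 =>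
          hul (Prod.ext (eq_neg_of_add_eq_zero_left h0) hl)
        simp [flipPerm, hu]
      · simp [Matrix.one_apply_ne hl]
    · simp
  rw [bcircZ, Matrix.add_apply, Matrix.smul_apply, toQuat, toQuat, Matrix.map_apply,
    Matrix.map_apply, h]
  rfl

omit [NeZero N] in
theorem toQuat_kronecker_one_mul_apply {n : ℕ} {κ : Type*} (F : Matrix (Fin N) (Fin N) ℂ)
    (M : Matrix (Fin N × Fin n) κ ℍ[ℝ]) (p : Fin N × Fin n) (q : κ) :
    (toQuat (F ⊗ₖ (1 : Matrix (Fin n) (Fin n) ℂ)) * M) p q =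
      ∑ a, (F p.1 a : ℍ[ℝ]) * M (a, p.2) q := by
  rw [Matrix.mul_apply, Fintype.sum_prod_type]
  refine Finset.sum_congr rfl fun a _ => ?_
  rw [Finset.sum_eq_single p.2]
  · simp [toQuat]
  · intro l _ hl
    simp [toQuat, Matrix.one_apply_ne hl.symm]
  · simp

omit [NeZero N] in
theorem blockDiag3_mul_apply {n : ℕ} {κ : Type*} (B : Tensor3 ℍ[ℝ] n n N)
    (M : Matrix (Fin N × Fin n) κ ℍ[ℝ]) (p : Fin N × Fin n) (q : κ) :
    (blockDiag3 B * M) p q = ∑ l, B p.1 p.2 l * M (p.1, l) q := by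
  rw [Matrix.mul_apply, Fintype.sum_prod_type, Finset.sum_eq_single p.1]
  · simp [blockDiag3]
  · intro a _ ha
    simp [blockDiag3, ha.symm]
  · simp

theorem toQuat_mul {l m k : Type} [Fintype m] (M : Matrix l m ℂ) (L : Matrix m k ℂ) :
    toQuat (M * L) = toQuat M * toQuat L :=
  Matrix.map_mul (f := Quaternion.ofComplex.toRingHom)

/-- The characters turn the shifts `s - t` in the `A_d` part, and `s + t` in the conjugated `A_c`
part, into the same right factor `F s t`. -/
theorem dftMatrix_mul_bcircZ {n : ℕ} (A : Tensor3 ℍ[ℝ] n n N) :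
    toQuat (dftMatrix N ⊗ₖ (1 : Matrix (Fin n) (Fin n) ℂ)) * bcircZ A =
      blockDiag3 (dftSlices A) * toQuat (dftMatrix N ⊗ₖ (1 : Matrix (Fin n) (Fin n) ℂ)) := by
  ext1 ⟨s, i⟩ ⟨t, k⟩
  have hslice (r : Fin N) : A r i k = (partD A r i k : ℍ[ℝ]) + quatJ * (partC A r i k : ℍ[ℝ]) :=
    congrFun (congrFun (slice_eq_partD_add_partC A r) i) k
  rw [toQuat_kronecker_one_mul_apply, blockDiag3_mul_apply, Finset.sum_eq_single k]
  · simp only [bcircZ_apply, mul_add, Finset.sum_add_distrib]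
    -- Substitute `a = r + t` in the first sum and `a = r - t` in the second, so that both involve
    -- slice `r`.
    rw [← Equiv.sum_comp (Equiv.addRight t),
      ← Equiv.sum_comp (Equiv.subRight t) fun a => (dftMatrix N s a : ℍ[ℝ]) *
        (quatJ * (partC A (a + t) i k : ℍ[ℝ])), ← Finset.sum_add_distrib]
    simp only [Equiv.coe_addRight, Equiv.subRight_apply, add_sub_cancel_right, sub_add_cancel]
    have hF : toQuat (dftMatrix N ⊗ₖ (1 : Matrix (Fin n) (Fin n) ℂ)) (s, k) (t, k) =
        dftMatrix N s t := by simp [toQuat]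
    rw [hF, dftSlices, mixSlices_apply, Finset.sum_mul]
    refine Finset.sum_congr rfl fun r _ => ?_
    rw [hslice, mul_assoc, add_mul, mul_add]
    congr 1
    · simp only [← Quaternion.coeComplex_mul]
      congr 1
      simp only [dftMatrix_eq, Matrix.smul_apply, smul_eq_mul, dftChar_add]
      ring
    · rw [mul_assoc quatJ, ← Quaternion.coeComplex_mul, mul_comm (partC A r i k),
        Quaternion.coeComplex_mul, ← mul_assoc quatJ,
        quatJ_mul_coeComplex (dftMatrix N s t)]
      simp only [← mul_assoc, ← Quaternion.coeComplex_mul]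
      congr 3
      simp only [dftMatrix_eq, Matrix.smul_apply, smul_eq_mul, dftChar_sub, map_mul,
        Complex.conj_ofReal]
      ring
  · intro l _ hl
    simp [toQuat, Matrix.one_apply_ne hl]
  · simp

theorem dftConj_eq_blockDiag3 {n : ℕ} (A : Tensor3 ℍ[ℝ] n n N) :
    dftConj A = blockDiag3 (dftSlices A) := by
  rw [dftConj, dftMatrix_mul_bcircZ, Matrix.mul_assoc, ← toQuat_mul, ← Matrix.mul_kronecker_mul,
    dftMatrix_mul_conjTranspose, Matrix.one_mul, Matrix.one_kronecker_one]
  have : toQuat (1 : Matrix (Fin N × Fin n) (Fin N × Fin n) ℂ) = 1 :=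
    Matrix.map_one _ rfl rfl
  rw [this, Matrix.mul_one]

/-- Apply `F ⊗ I` to the block column of the product; the normalization of `F` is a nonzero real,
hence central, and cancels. -/
theorem dftSlices_qtMul {n : ℕ} (A B : Tensor3 ℍ[ℝ] n n N) (s : Fin N) :
    dftSlices (qtMul A B) s = dftSlices A s * dftSlices B s := by
  have hsqrt : (Real.sqrt N)⁻¹ ≠ 0 :=
    inv_ne_zero (Real.sqrt_ne_zero'.mpr (Nat.cast_pos.mpr (NeZero.pos N)))
  have hF (C : Tensor3 ℍ[ℝ] n n N) (s : Fin N) (i k : Fin n) :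
      (toQuat (dftMatrix N ⊗ₖ (1 : Matrix (Fin n) (Fin n) ℂ)) * unfoldT C) (s, i) k =
        (((Real.sqrt N)⁻¹ : ℝ) : ℍ[ℝ]) * dftSlices C s i k := by
    rw [toQuat_kronecker_one_mul_apply, dftSlices, mixSlices_apply, Finset.mul_sum]
    refine Finset.sum_congr rfl fun a _ => ?_
    rw [dftMatrix_eq, Matrix.smul_apply, smul_eq_mul, Quaternion.coeComplex_mul, mul_assoc]
    rfl
  have hu : unfoldT (qtMul A B) = bcircZ A * unfoldT B := rfl
  ext1 i k
  have h := hF (qtMul A B) s i k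
  rw [hu, ← Matrix.mul_assoc, dftMatrix_mul_bcircZ, Matrix.mul_assoc, blockDiag3_mul_apply] at h
  simp only [hF, ← mul_assoc, ← Quaternion.coe_commutes] at h
  simp only [mul_assoc, ← Finset.mul_sum] at h
  rw [Matrix.mul_apply]
  refine (mul_left_cancel₀ ?_ h).symm
  rwa [Ne, ← Quaternion.coe_zero, Quaternion.coe_inj]

theorem dftSlices_qtOne (n : ℕ) (s : Fin N) : dftSlices (qtOne n N) s = 1 := by
  rw [dftSlices, mixSlices, Finset.sum_eq_single 0]
  · simp [qtOne, dftChar]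
  · intro r _ hr
    simp [qtOne, hr]
  · simp

end
end

/-! ### Slicewise Jordan forms and the inverse transform. -/

theorem mainTheorem8 (n n₃ : ℕ) [NeZero n₃] (A : Tensor3 (Quaternion ℝ) n n n₃) :
    ∃ P Pinv J : Tensor3 (Quaternion ℝ) n n n₃,
      IsQTInverse P Pinv ∧
      IsQTJordanForm A J ∧
      IsFUpperTriangular J ∧
      A = qtMul (qtMul P J) Pinv := by
  choose Jhat hJ htri using fun s => exists_isQuatJordanForm (dftSlices A s)
  choose P Q hPQ hQP hA using fun s => (hJ s).2
  refine ⟨mixSlices (dftCharInv n₃) P, mixSlices (dftCharInv n₃) Q,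
    mixSlices (dftCharInv n₃) Jhat, ⟨?_, ?_⟩, ?_, ?_, ?_⟩
  · apply dftSlices_injective
    funext s
    rw [dftSlices_qtMul, dftSlices_mixSlices_inv, dftSlices_mixSlices_inv, hPQ, dftSlices_qtOne]
  · apply dftSlices_injective
    funext s
    rw [dftSlices_qtMul, dftSlices_mixSlices_inv, dftSlices_mixSlices_inv, hQP, dftSlices_qtOne]
  · refine ⟨dftSlices A, Jhat, dftConj_eq_blockDiag3 A, ?_, hJ⟩
    rw [dftConj_eq_blockDiag3, dftSlices_mixSlices_inv]
  · intro s i k hik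
    rw [mixSlices_apply]
    -- The inverse transform combines slices entrywise, so common zeros below the diagonal persist.
    exact Finset.sum_eq_zero fun r _ => by rw [htri r i k hik, mul_zero]
  · apply dftSlices_injective
    funext s
    rw [dftSlices_qtMul, dftSlices_qtMul, dftSlices_mixSlices_inv, dftSlices_mixSlices_inv,
      dftSlices_mixSlices_inv]
    exact hA s
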